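/- Let $\mathcal Q$ be a small quantaloid, i.e. a small category whose hom-sets are complete lattices and whose composition preserves joins in each variable. For arrows $f:X\to Y$, $g:Y\to Z$, $h:X\to Z$ of a quantaloid, $h\swarrow f$ (resp. $g\searrow h$) denotes the largest $g'$ with $g'\circ f\le h$ (resp. the largest $f'$ with $g\circ f'\le h$). **Definitions.** A $\mathcal Q$-category $\mathbb A$ is a set $\mathbb A_0$ with a type map $t:\mathbb A_0\to\mathrm{ob}\,\mathcal Q$ and arrows $\mathbb A(x,y)\in\mathcal Q(tx,ty)$ with $1_{tx}\le\mathbb A(x,x)$ and $\mathbb A(y,z)\circ\mathbb A(x,y)\le\mathbb A(x,z)$. It has the preorder $x\le y\iff tx=ty$ and $1_{tx}\le\mathbb A(x,y)$, and is skeletal if this is a partial order. A $\mathcal Q$-functor $F:\mathbb A\to\mathbb B$ is a type-preserving map with $\mathbb A(x,y)\le\mathbb B(Fx,Fy)$; $\mathcal Q$-functors are ordered pointwise, and $F\dashv G$ means $1\le GF$ and $FG\le 1$. A $\mathcal Q$-distributor $\varphi:\mathbb A\to\mathbb B$ consists of arrows $\varphi(x,y)\in\mathcal Q(tx,ty)$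 with $\mathbb B(y,y')\circ\varphi(x,y)\circ\mathbb A(x',x)\le\varphi(x',y')$. With the pointwise order, the composition $(\psi\circ\varphi)(x,z)=\bigvee_y\psi(y,z)\circ\varphi(x,y)$ and the identities $\mathbb A$ (the hom-arrows), these form the quantaloid $\mathcal Q\text{-}\mathbf{Dist}$. Write $F_\natural(x,y)=\mathbb B(Fx,y)$ and $F^\natural(y,x)=\mathbb B(y,Fx)$ for the graph and cograph of $F:\mathbb A\to\mathbb B$. Presheaves of type $X$ on $\mathbb A$ are distributors from $\mathbb A$ to the one-object $\mathcal Q$-category $*_X$ (of type $X$, with hom-arrow $1_X$); they are the objects of the $\mathcal Q$-category $\mathcal P\mathbb A$ with $\mathcal P\mathbb A(\mu,\mu')=\mu'\swarrow\mu$. $\mathbb A$ is complete if the Yoneda embedding $\mathsf Y_{\mathbb A}:\mathbb A\to\mathcal P\mathbb A$, $x\mapsto\mathbb A(-,x)$, has a left adjoint. * $\mathcal Q\text{-}\mathbf{CCat}$ is the locally ordered 2-category of skeletal complete $\mathcal Q$-categories and left adjoint $\mathcal Q$-functors, ordered pointwise. * $\mathbf{ChuCon}(\mathcal Q\text{-}\mathbf{Dist})$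 is the locally ordered 2-category whose objects are the $\mathcal Q$-distributors and whose arrows from $\varphi:\mathbb A\to\mathbb B$ to $\psi:\mathbb A'\to\mathbb B'$ are the Chu connections, i.e. pairs of distributors $(\zeta:\mathbb A\to\mathbb A',\ \eta:\mathbb B\to\mathbb B')$ with $\varphi\swarrow\zeta=\eta\searrow\psi$, composed and ordered componentwise. In its opposite only the 1-cells are reversed. * $\mathcal J:\mathcal Q\text{-}\mathbf{CCat}\to\mathbf{ChuCon}(\mathcal Q\text{-}\mathbf{Dist})^{\mathrm{op}}$ is the 2-functor that sends $\mathbb A$ to the identity distributor on $\mathbb A$, and a left adjoint $F:\mathbb A\to\mathbb B$ with right adjoint $G$ to the Chu connection $(F^\natural,G_\natural)$ from the identity distributor on $\mathbb B$ to that on $\mathbb A$. * $\mathcal M:\mathbf{ChuCon}(\mathcal Q\text{-}\mathbf{Dist})^{\mathrm{op}}\to\mathcal Q\text{-}\mathbf{CCat}$ is the 2-functor that sends $\varphi:\mathbb A\to\mathbb B$ to the full $\mathcal Q$-subcategory $\mathcal M\varphi$ of $\mathcal P\mathbb A$ on the fixed points of $\varphi^{\downarrow}\varphi_{\uparrow}:\mu\mapsto(\varphi\swarrow\mu)\searrow\varphi$,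 and a Chu connection $(\zeta,\eta):\varphi\to\psi$ to the left adjoint $\mathcal M\psi\to\mathcal M\varphi$, $\mu'\mapsto\varphi^{\downarrow}\varphi_{\uparrow}(\mu'\circ\zeta)$. **Theorem.** $\mathcal Q\text{-}\mathbf{CCat}$ is a retract of $\mathbf{ChuCon}(\mathcal Q\text{-}\mathbf{Dist})^{\mathrm{op}}$ in $2\text{-}\mathbf{CAT}$. More precisely, the Yoneda embeddings $\mathsf Y_{\mathbb A}$, with codomain restricted to $\mathcal M\mathcal J\mathbb A$, are the components of a natural isomorphism from the identity 2-functor on $\mathcal Q\text{-}\mathbf{CCat}$ to $\mathcal M\mathcal J$; and there is a 2-functor $\mathcal R:\mathbf{ChuCon}(\mathcal Q\text{-}\mathbf{Dist})^{\mathrm{op}}\to\mathcal Q\text{-}\mathbf{CCat}$ with $\mathcal R\mathcal J$ equal to the identity 2-functor. -/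

import Mathlib

open CategoryTheory

universe u v w v₁ w₁ v₂ w₂ v₃ w₃

/-! ## Locally ordered 2-categories and 2-functors -/

/-- A locally ordered 2-category: a category whose hom-sets are partially ordered and whose
composition is monotone in both variables. There is (exactly) one 2-cell `f ⟶ f'` when `f ≤ f'`. -/
class LocallyOrdered (C : Type w) [Category.{v} C] where
  [homOrder : ∀ X Y : C, PartialOrder (X ⟶ Y)]
  comp_le_comp : ∀ {X Y Z : C} {f f' : X ⟶ Y} {g g' : Y ⟶ Z},
    f ≤ f' → g ≤ g' → f ≫ g ≤ f' ≫ g'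

attribute [reducible, instance] LocallyOrdered.homOrder

/-- The opposite of a locally ordered 2-category reverses the 1-cells and keeps the 2-cells. -/
instance LocallyOrdered.opposite (C : Type w) [Category.{v} C] [LocallyOrdered C] :
    LocallyOrdered Cᵒᵖ where
  homOrder X Y := PartialOrder.lift (fun f : X ⟶ Y => f.unop) (fun _ _ h => Quiver.Hom.unop_inj h)
  comp_le_comp := fun hf hg => LocallyOrdered.comp_le_comp (C := C) hg hf

/-- A 2-functor between locally ordered 2-categories: a functor that preserves the local order.
(All the coherence for 2-cells is automatic since 2-cells are unique; for the same reason a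
2-natural isomorphism of such 2-functors is a natural isomorphism of the underlying functors.) -/
structure TwoFunctor (C : Type w₁) [Category.{v₁} C] [LocallyOrdered C]
    (D : Type w₂) [Category.{v₂} D] [LocallyOrdered D] extends C ⥤ D where
  map_le_map : ∀ {X Y : C} {f g : X ⟶ Y}, f ≤ g → map f ≤ map g

/-- The identity 2-functor. -/
def TwoFunctor.id (C : Type w₁) [Category.{v₁} C] [LocallyOrdered C] : TwoFunctor C C where
  toFunctor := 𝟭 C
  map_le_map h := h

/-- The composite of two 2-functors, in diagrammatic order. -/
def TwoFunctor.comp {C : Type w₁} [Category.{v₁} C] [LocallyOrdered C]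
    {D : Type w₂} [Category.{v₂} D] [LocallyOrdered D]
    {E : Type w₃} [Category.{v₃} E] [LocallyOrdered E]
    (F : TwoFunctor C D) (G : TwoFunctor D E) : TwoFunctor C E where
  toFunctor := F.toFunctor ⋙ G.toFunctor
  map_le_map h := G.map_le_map (F.map_le_map h)

/-! ## Quantaloids -/

/-- A quantaloid: a category whose hom-sets are complete lattices and whose composition preserves
arbitrary joins in each variable. (Composition is written diagrammatically: `f ≫ g` is `g ∘ f`.) -/
class Quantaloid (C : Type w) [Category.{v} C] where
  [homLattice : ∀ X Y : C, CompleteLattice (X ⟶ Y)]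
  sSup_comp : ∀ {X Y Z : C} (S : Set (X ⟶ Y)) (g : Y ⟶ Z), sSup S ≫ g = ⨆ f ∈ S, f ≫ g
  comp_sSup : ∀ {X Y Z : C} (f : X ⟶ Y) (S : Set (Y ⟶ Z)), f ≫ sSup S = ⨆ g ∈ S, f ≫ g

attribute [reducible, instance] Quantaloid.homLattice

namespace Quantaloid

variable {C : Type w} [Category.{v} C] [Quantaloid C]

/-- The left implication `h ↙ f`, the largest `g` with `g ∘ f ≤ h`. -/
def lda {X Y Z : C} (h : X ⟶ Z) (f : X ⟶ Y) : Y ⟶ Z := sSup {g | f ≫ g ≤ h}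

/-- The right implication `g ↘ h`, the largest `f` with `g ∘ f ≤ h`. -/
def rda {X Y Z : C} (g : Y ⟶ Z) (h : X ⟶ Z) : X ⟶ Y := sSup {f | f ≫ g ≤ h}

theorem comp_mono {X Y Z : C} {f f' : X ⟶ Y} {g g' : Y ⟶ Z} (hf : f ≤ f') (hg : g ≤ g') :
    f ≫ g ≤ f' ≫ g' := by
  have h1 : f' = sSup {f, f'} := by rw [sSup_pair, sup_eq_right.2 hf]
  have h2 : g' = sSup {g, g'} := by rw [sSup_pair, sup_eq_right.2 hg]
  calc f ≫ g ≤ f' ≫ g := by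
        rw [h1, sSup_comp]
        exact le_iSup₂_of_le f (by simp) le_rfl
    _ ≤ f' ≫ g' := by
        rw [h2, comp_sSup]
        exact le_iSup₂_of_le g (by simp) le_rfl

theorem le_lda {X Y Z : C} {h : X ⟶ Z} {f : X ⟶ Y} {g : Y ⟶ Z} : g ≤ lda h f ↔ f ≫ g ≤ h := by
  refine ⟨fun hg => ?_, fun hg => le_sSup hg⟩
  refine (comp_mono le_rfl hg).trans ?_
  rw [lda, comp_sSup]
  exact iSup₂_le fun _ h => h

theorem le_rda {X Y Z : C} {h : X ⟶ Z} {f : X ⟶ Y} {g : Y ⟶ Z} : f ≤ rda g h ↔ f ≫ g ≤ h := by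
  refine ⟨fun hg => ?_, fun hg => le_sSup hg⟩
  refine (comp_mono hg le_rfl).trans ?_
  rw [rda, sSup_comp]
  exact iSup₂_le fun _ h => h

theorem eq_lda_iff {X Y Z : C} {h : X ⟶ Z} {f : X ⟶ Y} {g : Y ⟶ Z} :
    g = lda h f ↔ ∀ k, k ≤ g ↔ f ≫ k ≤ h := by
  refine ⟨fun e k => e ▸ le_lda, fun H => le_antisymm (le_lda.2 ((H g).1 le_rfl))
    ((H _).2 (le_lda.1 le_rfl))⟩

theorem lda_comp {X Y Z W : C} (h : X ⟶ Z) (f : X ⟶ Y) (g : Y ⟶ W) :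
    lda h (f ≫ g) = lda (lda h f) g := by
  rw [eq_lda_iff]
  intro k
  rw [le_lda, le_lda, Category.assoc]

theorem rda_comp {X Y Z W : C} (h : X ⟶ Z) (f : Y ⟶ W) (g : W ⟶ Z) :
    rda (f ≫ g) h = rda f (rda g h) := by
  refine le_antisymm (le_rda.2 (le_rda.2 ?_)) (le_rda.2 ?_)
  · rw [Category.assoc]; exact le_rda.1 le_rfl
  · rw [← Category.assoc]; exact le_rda.1 (le_rda.1 le_rfl)

theorem rda_lda {X Y Z W : C} (g : Y ⟶ Z) (h : X ⟶ Z) (f : X ⟶ W) :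
    lda (rda g h) f = rda g (lda h f) := by
  refine le_antisymm (le_rda.2 (le_lda.2 ?_)) (le_lda.2 (le_rda.2 ?_))
  · rw [← Category.assoc]; exact le_rda.1 (le_lda.1 le_rfl)
  · rw [Category.assoc]; exact le_lda.1 (le_rda.1 le_rfl)

theorem lda_id {X Z : C} (h : X ⟶ Z) : lda h (𝟙 X) = h :=
  (eq_lda_iff.2 fun k => by rw [Category.id_comp]).symm

theorem rda_id {X Z : C} (h : X ⟶ Z) : rda (𝟙 Z) h = h := by
  refine le_antisymm ?_ (le_rda.2 (by rw [Category.comp_id]))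
  have := le_rda.1 (le_refl (rda (𝟙 Z) h))
  rwa [Category.comp_id] at this

end Quantaloid

open Quantaloid

/-! ## Chu connections in a quantaloid -/

/-- Objects of the category of Chu connections in `C`: the arrows of `C`. -/
structure ChuCon (C : Type w) [Category.{v} C] where
  {dom : C}
  {cod : C}
  arr : dom ⟶ cod

namespace ChuCon

variable {C : Type w} [Category.{v} C] [Quantaloid C]

/-- A Chu connection from `f` to `g`: a pair `(u, v)` with `f ↙ u = v ↘ g`. -/
@[ext]
structure Hom (f g : ChuCon C) where
  u : f.dom ⟶ g.dom
  v : f.cod ⟶ g.cod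
  lda_eq_rda : lda f.arr u = rda v g.arr

instance : Category (ChuCon C) where
  Hom f g := Hom f g
  id f := ⟨𝟙 _, 𝟙 _, by rw [lda_id, rda_id]⟩
  comp p q := ⟨p.u ≫ q.u, p.v ≫ q.v, by
    rw [lda_comp, p.lda_eq_rda, rda_lda, q.lda_eq_rda, rda_comp]⟩
  id_comp p := Hom.ext (Category.id_comp _) (Category.id_comp _)
  comp_id p := Hom.ext (Category.comp_id _) (Category.comp_id _)
  assoc p q r := Hom.ext (Category.assoc _ _ _) (Category.assoc _ _ _)

/-- Chu connections are ordered componentwise. -/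
instance : LocallyOrdered (ChuCon C) where
  homOrder f g := PartialOrder.lift (fun p : Hom f g => (p.u, p.v)) fun p q h => by
    obtain ⟨h1, h2⟩ := Prod.mk.inj h
    exact Hom.ext h1 h2
  comp_le_comp := fun hf hg => ⟨comp_mono hf.1 hg.1, comp_mono hf.2 hg.2⟩

end ChuCon

/-! ## Categories, functors and distributors enriched in a small quantaloid -/

/-- A (small) `Q`-category. The set of objects with its type map to `ob Q` is given by its fibres:
`Obj X` is the set of objects of type `X`. -/
structure QCategory (Q : Type u) [Category.{u} Q] [Quantaloid Q] where
  Obj : Q → Type u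
  hom : ∀ {X Y : Q}, Obj X → Obj Y → (X ⟶ Y)
  id_le : ∀ {X : Q} (x : Obj X), 𝟙 X ≤ hom x x
  comp_le : ∀ {X Y Z : Q} (x : Obj X) (y : Obj Y) (z : Obj Z), hom x y ≫ hom y z ≤ hom x z

/-- A `Q`-functor: a type-preserving map on objects with `A(x, y) ≤ B(F x, F y)`. -/
@[ext]
structure QFunctor {Q : Type u} [Category.{u} Q] [Quantaloid Q] (A B : QCategory Q) where
  obj : ∀ {X : Q}, A.Obj X → B.Obj X
  hom_le : ∀ {X Y : Q} (x : A.Obj X) (y : A.Obj Y), A.hom x y ≤ B.hom (obj x) (obj y)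

/-- A `Q`-distributor `A ⇸ B`. -/
@[ext]
structure QDistributor {Q : Type u} [Category.{u} Q] [Quantaloid Q] (A B : QCategory Q) where
  val : ∀ {X Y : Q}, A.Obj X → B.Obj Y → (X ⟶ Y)
  act_le : ∀ {X' X Y Y' : Q} (x' : A.Obj X') (x : A.Obj X) (y : B.Obj Y) (y' : B.Obj Y'),
    A.hom x' x ≫ val x y ≫ B.hom y y' ≤ val x' y'

section QEnriched

variable {Q : Type u} [Category.{u} Q] [Quantaloid Q]

namespace QCategory

/-- The underlying (pre)order on the objects of a given type. -/
def le (A : QCategory Q) {X : Q} (x y : A.Obj X) : Prop := 𝟙 X ≤ A.hom x y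

/-- `A` is skeletal if its underlying preorder is a partial order. -/
def Skeletal (A : QCategory Q) : Prop :=
  ∀ {X : Q} (x y : A.Obj X), A.le x y → A.le y x → x = y

theorem le_refl (A : QCategory Q) {X : Q} (x : A.Obj X) : A.le x x := A.id_le x

theorem le_trans (A : QCategory Q) {X : Q} {x y z : A.Obj X} (h : A.le x y) (h' : A.le y z) :
    A.le x z := by
  have := (comp_mono h h').trans (A.comp_le x y z)
  rwa [Category.comp_id] at this

theorem hom_le_of_le_right (A : QCategory Q) {X Y : Q} (x : A.Obj X) {y y' : A.Obj Y}
    (h : A.le y y') : A.hom x y ≤ A.hom x y' := by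
  have := (comp_mono (_root_.le_refl (A.hom x y)) h).trans (A.comp_le x y y')
  rwa [Category.comp_id] at this

theorem hom_le_of_le_left (A : QCategory Q) {X Y : Q} {x x' : A.Obj X} (y : A.Obj Y)
    (h : A.le x x') : A.hom x' y ≤ A.hom x y := by
  have := (comp_mono h (_root_.le_refl (A.hom x' y))).trans (A.comp_le x x' y)
  rwa [Category.id_comp] at this

/-- The full `Q`-subcategory of `A` on the objects that satisfy `P`. -/
abbrev full (A : QCategory Q) (P : ∀ {X : Q}, A.Obj X → Prop) : QCategory Q where
  Obj X := {x : A.Obj X // P x}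
  hom x y := A.hom x.1 y.1
  id_le x := A.id_le x.1
  comp_le x y z := A.comp_le x.1 y.1 z.1

end QCategory

namespace QFunctor

variable {A B D : QCategory Q}

/-- The identity `Q`-functor. -/
def id (A : QCategory Q) : QFunctor A A where
  obj x := x
  hom_le _ _ := le_rfl

/-- Composition of `Q`-functors, in diagrammatic order. -/
def comp (F : QFunctor A B) (G : QFunctor B D) : QFunctor A D where
  obj x := G.obj (F.obj x)
  hom_le x y := (F.hom_le x y).trans (G.hom_le _ _)

/-- The pointwise order of `Q`-functors. -/
instance : LE (QFunctor A B) := ⟨fun F G => ∀ {X : Q} (x : A.Obj X), B.le (F.obj x) (G.obj x)⟩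

/-- `F ⊣ G` in the locally ordered 2-category of `Q`-categories and `Q`-functors. -/
def Adj (F : QFunctor A B) (G : QFunctor B A) : Prop :=
  QFunctor.id A ≤ F.comp G ∧ G.comp F ≤ QFunctor.id B

theorem map_le (F : QFunctor A B) {X : Q} {x y : A.Obj X} (h : A.le x y) :
    B.le (F.obj x) (F.obj y) := _root_.le_trans h (F.hom_le x y)

theorem Adj.hom_eq {F : QFunctor A B} {G : QFunctor B A} (h : F.Adj G) {X Y : Q} (x : A.Obj X)
    (y : B.Obj Y) : B.hom (F.obj x) y = A.hom x (G.obj y) :=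
  le_antisymm ((G.hom_le _ _).trans (A.hom_le_of_le_left _ (h.1 x)))
    ((F.hom_le _ _).trans (B.hom_le_of_le_right _ (h.2 y)))

theorem Adj.comp {F : QFunctor A B} {G : QFunctor B A} {F' : QFunctor B D} {G' : QFunctor D B}
    (h : F.Adj G) (h' : F'.Adj G') : (F.comp F').Adj (G'.comp G) :=
  ⟨fun x => A.le_trans (h.1 x) (G.map_le (h'.1 (F.obj x))),
    fun z => D.le_trans (F'.map_le (h.2 (G'.obj z))) (h'.2 z)⟩

theorem Adj.unique {F : QFunctor A B} {G G' : QFunctor B A} (hA : A.Skeletal) (h : F.Adj G)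
    (h' : F.Adj G') : G = G' := by
  have key : ∀ {G G' : QFunctor B A}, F.Adj G → F.Adj G' → ∀ {X : Q} (y : B.Obj X),
      A.le (G.obj y) (G'.obj y) := fun {G G'} h h' X y => by
    have := h.2 y
    exact this.trans_eq (h'.hom_eq _ _)
  ext X y
  exact hA _ _ (key h h' y) (key h' h y)

end QFunctor

namespace QDistributor

variable {A B D E : QCategory Q}

theorem act_left (φ : QDistributor A B) {X' X Y : Q} (x' : A.Obj X') (x : A.Obj X)
    (y : B.Obj Y) : A.hom x' x ≫ φ.val x y ≤ φ.val x' y := by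
  have := (comp_mono (le_refl (A.hom x' x)) (comp_mono (le_refl (φ.val x y)) (B.id_le y))).trans
    (φ.act_le x' x y y)
  rwa [Category.comp_id] at this

theorem act_right (φ : QDistributor A B) {X Y Y' : Q} (x : A.Obj X) (y : B.Obj Y)
    (y' : B.Obj Y') : φ.val x y ≫ B.hom y y' ≤ φ.val x y' := by
  have := (comp_mono (A.id_le x) (le_refl (φ.val x y ≫ B.hom y y'))).trans (φ.act_le x x y y')
  rwa [Category.id_comp] at this

/-- Distributors are ordered pointwise. -/
instance : PartialOrder (QDistributor A B) :=
  PartialOrder.lift (fun φ => fun (X Y : Q) (x : A.Obj X) (y : B.Obj Y) => φ.val x y)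
    fun φ ψ h => by
      ext X Y x y
      exact congrFun (congrFun (congrFun (congrFun h X) Y) x) y

/-- Pointwise joins of distributors. -/
instance : SupSet (QDistributor A B) where
  sSup S :=
    { val := fun x y => ⨆ φ ∈ S, φ.val x y
      act_le := fun x' x y y' => by
        rw [← le_lda, ← le_rda]
        refine iSup₂_le fun φ hφ => ?_
        rw [le_rda, le_lda]
        exact le_iSup₂_of_le (f := fun (φ : QDistributor A B) (_ : φ ∈ S) => φ.val x' y') φ hφ
          (φ.act_le x' x y y') }

theorem isLUB_sSup (S : Set (QDistributor A B)) : IsLUB S (sSup S) :=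
  ⟨fun φ hφ _ _ x y => le_iSup₂_of_le (f := fun (φ : QDistributor A B) (_ : φ ∈ S) => φ.val x y)
      φ hφ le_rfl,
    fun _ hψ _ _ x y => iSup₂_le fun _ hφ => hψ hφ _ _ x y⟩

instance : CompleteLattice (QDistributor A B) := completeLatticeOfSup _ isLUB_sSup

/-- The identity distributor, given by the hom-arrows. -/
def id (A : QCategory Q) : QDistributor A A where
  val x y := A.hom x y
  act_le x' x y y' := (comp_mono le_rfl (A.comp_le x y y')).trans (A.comp_le x' x y')

/-- Composition of distributors (diagrammatic order):
`(ψ ∘ φ)(x, z) = ⋁_y ψ(y, z) ∘ φ(x, y)`. -/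
def comp (φ : QDistributor A B) (ψ : QDistributor B D) : QDistributor A D where
  val x z := ⨆ (Y : Q) (y : B.Obj Y), φ.val x y ≫ ψ.val y z
  act_le x' x z z' := by
    rw [← le_lda, ← le_rda]
    refine iSup₂_le fun Y y => ?_
    rw [le_rda, le_lda]
    refine le_trans ?_ (le_iSup₂_of_le (f := fun (Y : Q) (y : B.Obj Y) =>
      φ.val x' y ≫ ψ.val y z') Y y le_rfl)
    rw [Category.assoc, ← Category.assoc]
    exact comp_mono (φ.act_left _ _ _) (ψ.act_right _ _ _)

theorem comp_le_iff {φ : QDistributor A B} {ψ : QDistributor B D} {ξ : QDistributor A D} :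
    φ.comp ψ ≤ ξ ↔ ∀ {X Y Z : Q} (x : A.Obj X) (y : B.Obj Y) (z : D.Obj Z),
      φ.val x y ≫ ψ.val y z ≤ ξ.val x z :=
  ⟨fun h _ Y Z x y z => (le_iSup₂_of_le (f := fun (Y : Q) (y : B.Obj Y) => φ.val x y ≫ ψ.val y z)
      Y y le_rfl).trans (h _ Z x z),
    fun h _ _ x z => iSup₂_le fun _ y => h x y z⟩

theorem le_comp (φ : QDistributor A B) (ψ : QDistributor B D) {X Y Z : Q} (x : A.Obj X)
    (y : B.Obj Y) (z : D.Obj Z) : φ.val x y ≫ ψ.val y z ≤ (φ.comp ψ).val x z :=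
  comp_le_iff.1 le_rfl x y z

theorem comp_val_le {φ : QDistributor A B} {ψ : QDistributor B D} {X Z : Q} {x : A.Obj X}
    {z : D.Obj Z} {k : X ⟶ Z} (h : ∀ {Y : Q} (y : B.Obj Y), φ.val x y ≫ ψ.val y z ≤ k) :
    (φ.comp ψ).val x z ≤ k := iSup₂_le fun _ y => h y

theorem iSup₂_comp' {ι : Type*} {κ : ι → Sort*} {X Y Z : Q} (f : ∀ i, κ i → (X ⟶ Y))
    (g : Y ⟶ Z) {k : X ⟶ Z} : (⨆ (i) (j), f i j) ≫ g ≤ k ↔ ∀ i j, f i j ≫ g ≤ k := by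
  simp only [← le_rda, iSup_le_iff]

theorem comp_iSup₂' {ι : Type*} {κ : ι → Sort*} {X Y Z : Q} (f : X ⟶ Y)
    (g : ∀ i, κ i → (Y ⟶ Z)) {k : X ⟶ Z} :
    f ≫ (⨆ (i) (j), g i j) ≤ k ↔ ∀ i j, f ≫ g i j ≤ k := by
  simp only [← le_lda, iSup_le_iff]

theorem sSup_comp' (S : Set (QDistributor A B)) (ψ : QDistributor B D) :
    (sSup S).comp ψ = ⨆ φ ∈ S, φ.comp ψ := by
  refine le_antisymm ?_ (iSup₂_le fun φ hφ => ?_)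
  · refine comp_le_iff.2 fun x y z => ?_
    refine (iSup₂_comp' (κ := fun φ => φ ∈ S) (fun φ _ => φ.val x y) _).2 fun φ hφ => ?_
    exact (le_comp φ ψ x y z).trans
      ((le_iSup₂_of_le (f := fun (φ : QDistributor A B) (_ : φ ∈ S) => φ.comp ψ) φ hφ
        le_rfl) _ _ x z)
  · refine comp_le_iff.2 fun x y z => ?_
    exact (comp_mono ((isLUB_sSup S).1 hφ _ _ x y) le_rfl).trans (le_comp (sSup S) ψ x y z)

theorem comp_sSup' (φ : QDistributor A B) (S : Set (QDistributor B D)) :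
    φ.comp (sSup S) = ⨆ ψ ∈ S, φ.comp ψ := by
  refine le_antisymm ?_ (iSup₂_le fun ψ hψ => ?_)
  · refine comp_le_iff.2 fun x y z => ?_
    refine (comp_iSup₂' (κ := fun ψ => ψ ∈ S) _ (fun ψ _ => ψ.val y z)).2 fun ψ hψ => ?_
    exact (le_comp φ ψ x y z).trans
      ((le_iSup₂_of_le (f := fun (ψ : QDistributor B D) (_ : ψ ∈ S) => φ.comp ψ) ψ hψ
        le_rfl) _ _ x z)
  · refine comp_le_iff.2 fun x y z => ?_
    exact (comp_mono le_rfl ((isLUB_sSup S).1 hψ _ _ y z)).trans (le_comp φ (sSup S) x y z)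

end QDistributor

/-- The category `Q`-Dist: its objects are the `Q`-categories and its arrows the
`Q`-distributors. -/
abbrev QDist (Q : Type u) [Category.{u} Q] [Quantaloid Q] : Type (u + 1) := QCategory Q

instance : Category.{u} (QDist Q) where
  Hom A B := QDistributor A B
  id A := QDistributor.id A
  comp φ ψ := φ.comp ψ
  id_comp φ := by
    refine le_antisymm (QDistributor.comp_le_iff.2 fun x' x y => φ.act_left x' x y) ?_
    intro X Y x y
    refine le_trans ?_ (QDistributor.le_comp _ _ x x y)
    have := comp_mono (QCategory.id_le _ x) (le_refl (φ.val x y))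
    rwa [Category.id_comp] at this
  comp_id φ := by
    refine le_antisymm (QDistributor.comp_le_iff.2 fun x y y' => φ.act_right x y y') ?_
    intro X Y x y
    refine le_trans ?_ (QDistributor.le_comp _ _ x y y)
    have := comp_mono (le_refl (φ.val x y)) (QCategory.id_le _ y)
    rwa [Category.comp_id] at this
  assoc φ ψ ξ := by
    refine le_antisymm ?_ ?_
    · refine QDistributor.comp_le_iff.2 fun x z w => ?_
      refine (QDistributor.iSup₂_comp' _ _).2 fun Y y => ?_
      rw [Category.assoc]
      exact (comp_mono le_rfl (QDistributor.le_comp ψ ξ y z w)).trans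
        (QDistributor.le_comp φ (ψ.comp ξ) x y w)
    · refine QDistributor.comp_le_iff.2 fun x y w => ?_
      refine (QDistributor.comp_iSup₂' _ _).2 fun Z z => ?_
      rw [← Category.assoc]
      exact (comp_mono (QDistributor.le_comp φ ψ x y z) le_rfl).trans
        (QDistributor.le_comp (φ.comp ψ) ξ x z w)

/-- `Q`-Dist is a (large) quantaloid. -/
instance : Quantaloid (QDist Q) where
  homLattice A B := inferInstanceAs (CompleteLattice (QDistributor A B))
  sSup_comp S g := QDistributor.sSup_comp' S g
  comp_sSup f S := QDistributor.comp_sSup' f S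

namespace QFunctor

variable {A B : QCategory Q}

/-- The graph of a `Q`-functor `F : A → B`, the distributor `A ⇸ B` with value `B(F x, y)`. -/
def graph (F : QFunctor A B) : QDistributor A B where
  val x y := B.hom (F.obj x) y
  act_le x' x y y' := (comp_mono (F.hom_le x' x) (B.comp_le _ y y')).trans (B.comp_le _ _ y')

/-- The cograph of a `Q`-functor `F : A → B`, the distributor `B ⇸ A` with value `B(y, F x)`. -/
def cograph (F : QFunctor A B) : QDistributor B A where
  val y x := B.hom y (F.obj x)
  act_le y' y x x' :=
    (comp_mono le_rfl ((comp_mono le_rfl (F.hom_le x x')).trans (B.comp_le y _ _))).trans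
      (B.comp_le y' y _)

end QFunctor

/-! ## Presheaves, the Yoneda embedding, completeness -/

/-- The objects of the one-object `Q`-category of type `X`. -/
inductive StarObj {Q : Type u} (X : Q) : Q → Type u
  | pt : StarObj X X

/-- The `Q`-category with exactly one object, of type `X`, whose hom-arrow is the identity. -/
def starCat (X : Q) : QCategory Q where
  Obj := StarObj X
  hom
    | .pt, .pt => 𝟙 X
  id_le
    | .pt => le_rfl
  comp_le
    | .pt, .pt, .pt => (Category.comp_id _).le

/-- A `Q`-arrow `X ⟶ Y` as a distributor between one-object `Q`-categories. -/
def arrowDist {X Y : Q} (f : X ⟶ Y) :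
    (starCat X : QDist Q) ⟶ starCat Y where
  val
    | .pt, .pt => f
  act_le
    | .pt, .pt, .pt, .pt => by
      change 𝟙 X ≫ f ≫ 𝟙 Y ≤ f
      rw [Category.comp_id, Category.id_comp]

/-- A presheaf of type `X` on `A`, i.e. a distributor from `A` to the one-object
`Q`-category of type `X`. -/
abbrev Presheaf (A : QDist Q) (X : Q) : Type u := A ⟶ (starCat X : QDist Q)

/-- The value at an object `x` of a presheaf. -/
def Presheaf.at {A : QDist Q} {X Y : Q} (μ : Presheaf A Y) (x : A.Obj X) : X ⟶ Y :=
  QDistributor.val μ x StarObj.pt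

theorem Presheaf.le_iff {A : QDist Q} {Y : Q} {μ ν : Presheaf A Y} :
    μ ≤ ν ↔ ∀ {X : Q} (x : A.Obj X), μ.at x ≤ ν.at x :=
  ⟨fun h X x => h X Y x StarObj.pt, fun h X _ x y => by cases y; exact h x⟩

theorem Presheaf.comp_at {A B : QDist Q} {X Y : Q} (ζ : A ⟶ B) (μ : Presheaf B Y) (x : A.Obj X) :
    Presheaf.at (A := A) (ζ ≫ μ) x =
      ⨆ (Z : Q) (y : B.Obj Z), QDistributor.val ζ x y ≫ μ.at y := rfl

theorem Presheaf.comp_arrow_at {A : QDist Q} {X Y Z : Q} (μ : Presheaf A Y) (f : Y ⟶ Z)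
    (x : A.Obj X) :
    Presheaf.at (A := A) (μ ≫ arrowDist f) x = μ.at x ≫ f := by
  refine le_antisymm (iSup₂_le fun W w => ?_) ?_
  · cases w
    exact le_rfl
  · exact QDistributor.le_comp μ (arrowDist f) x StarObj.pt StarObj.pt

theorem le_at_pt {X Y : Q} {f : X ⟶ Y} {φ : (starCat X : QDist Q) ⟶ starCat Y} :
    f ≤ QDistributor.val φ StarObj.pt StarObj.pt ↔
      arrowDist f ≤ φ :=
  ⟨fun h _ _ x y => by cases x; cases y; exact h, fun h => h X Y StarObj.pt StarObj.pt⟩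

/-- The hom-arrows between presheaves, `PA(μ, μ') = μ' ↙ μ`. -/
def homPA {A : QDist Q} {X Y : Q} (μ : Presheaf A X) (μ' : Presheaf A Y) : X ⟶ Y :=
  QDistributor.val (lda μ' μ) StarObj.pt StarObj.pt

theorem le_homPA' {A : QDist Q} {X Y : Q} {μ : Presheaf A X} {μ' : Presheaf A Y}
    {f : X ⟶ Y} : f ≤ homPA μ μ' ↔
      μ ≫ arrowDist f ≤ μ' := by
  rw [homPA, le_at_pt, le_lda]

theorem le_homPA {A : QDist Q} {X Y : Q} {μ : Presheaf A X} {μ' : Presheaf A Y}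
    {f : X ⟶ Y} : f ≤ homPA μ μ' ↔
      ∀ {Z : Q} (x : A.Obj Z), μ.at x ≫ f ≤ μ'.at x := by
  rw [le_homPA', Presheaf.le_iff]
  simp only [Presheaf.comp_arrow_at]

theorem one_le_homPA {A : QDist Q} {X : Q} {μ μ' : Presheaf A X} :
    𝟙 X ≤ homPA μ μ' ↔ μ ≤ μ' := by
  rw [le_homPA, Presheaf.le_iff]
  simp only [Category.comp_id]

/-- The `Q`-category `PA` of presheaves on `A`. -/
abbrev presheafCat (A : QCategory Q) : QCategory Q where
  Obj X := Presheaf A X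
  hom μ μ' := homPA μ μ'
  id_le _ := one_le_homPA.2 le_rfl
  comp_le μ ν ξ := le_homPA.2 fun x => by
    rw [← Category.assoc]
    exact (comp_mono (le_homPA.1 le_rfl x) le_rfl).trans (le_homPA.1 le_rfl x)

/-- The Yoneda presheaf `A(-, x)`. -/
def yonedaObj (A : QCategory Q) {X : Q} (x : A.Obj X) : Presheaf A X where
  val
    | y, .pt => A.hom y x
  act_le
    | y', y, .pt, .pt => by
      change A.hom y' y ≫ A.hom y x ≫ 𝟙 X ≤ A.hom y' x
      rw [Category.comp_id]
      exact A.comp_le _ _ _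

/-- The Yoneda embedding `A → PA`. -/
def yonedaEmb (A : QCategory Q) : QFunctor A (presheafCat A) where
  obj x := yonedaObj A x
  hom_le x y := le_homPA.2 fun z => A.comp_le z x y

/-- `A` is complete if its Yoneda embedding has a left adjoint. -/
def QCategory.Complete (A : QCategory Q) : Prop :=
  ∃ sup : QFunctor (presheafCat A) A, sup.Adj (yonedaEmb A)

/-! ## Skeletal complete `Q`-categories and left adjoint `Q`-functors -/

/-- A skeletal complete `Q`-category. -/
structure QCCat (Q : Type u) [Category.{u} Q] [Quantaloid Q] extends QCategory Q where
  skeletal : toQCategory.Skeletal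
  complete : toQCategory.Complete

namespace QCCat

/-- A left adjoint `Q`-functor. -/
@[ext]
structure Hom (A B : QCCat Q) where
  functor : QFunctor A.toQCategory B.toQCategory
  exists_adj : ∃ G : QFunctor B.toQCategory A.toQCategory, functor.Adj G

instance : Category.{u} (QCCat Q) where
  Hom A B := Hom A B
  id A := ⟨QFunctor.id _, QFunctor.id _, fun x => A.le_refl x, fun x => A.le_refl x⟩
  comp F G := ⟨F.functor.comp G.functor, by
    obtain ⟨F', hF⟩ := F.exists_adj
    obtain ⟨G', hG⟩ := G.exists_adj
    exact ⟨_, hF.comp hG⟩⟩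

/-- The locally ordered 2-category of skeletal complete `Q`-categories and left adjoint
`Q`-functors, with the pointwise order of `Q`-functors. -/
instance : LocallyOrdered (QCCat Q) where
  homOrder A B :=
    { le := fun F G : Hom A B => F.functor ≤ G.functor
      le_refl := fun F _ x => B.le_refl (F.functor.obj x)
      le_trans := fun _ _ _ h h' _ x => B.le_trans (h x) (h' x)
      le_antisymm := fun F G h h' => by
        apply Hom.ext
        ext X x
        exact B.skeletal _ _ (h x) (h' x) }
  comp_le_comp := fun {_ _ D _ f' g _} hf hg _ x =>
    D.le_trans (QFunctor.map_le g.functor (hf x)) (hg (f'.functor.obj x))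

/-- The right adjoint of an arrow `F` (it is unique, the categories being skeletal). -/
noncomputable def rightAdj {A B : QCCat Q} (F : A ⟶ B) :
    QFunctor B.toQCategory A.toQCategory := F.exists_adj.choose

theorem adj {A B : QCCat Q} (F : A ⟶ B) : F.functor.Adj (rightAdj F) := F.exists_adj.choose_spec

end QCCat

/-! ## The 2-functor `J` -/

/-- An adjunction `F ⊣ G : B → A` gives a Chu connection `(F^♮, G_♮)` from the identity
distributor on `B` to the identity distributor on `A`. -/
def QFunctor.Adj.chuHom {A B : QCategory Q} {F : QFunctor A B} {G : QFunctor B A}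
    (h : F.Adj G) :
    ChuCon.mk (𝟙 (B : QDist Q)) ⟶ ChuCon.mk (𝟙 (A : QDist Q)) where
  u := F.cograph
  v := G.graph
  lda_eq_rda := by
    have key : F.graph = G.cograph := by
      apply QDistributor.ext
      funext X Y x y
      exact h.hom_eq x y
    have e1 : lda (𝟙 (B : QDist Q)) F.cograph = F.graph := by
      refine le_antisymm ?_ (le_lda.2 ?_)
      · intro X Y x y
        have h1 := le_lda.1 (le_refl (lda (𝟙 (B : QDist Q)) F.cograph))
        have h2 := QDistributor.comp_le_iff.1 h1 (F.obj x) x y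
        have h3 := comp_mono (B.id_le (F.obj x))
          (le_refl ((lda (𝟙 (B : QDist Q)) F.cograph : QDistributor A B).val x y))
        rw [Category.id_comp] at h3
        exact h3.trans h2
      · exact QDistributor.comp_le_iff.2 fun x y z => B.comp_le x (F.obj y) z
    have e2 : rda (G.graph : (B : QDist Q) ⟶ A) (𝟙 (A : QDist Q)) = G.cograph := by
      refine le_antisymm ?_ (le_rda.2 ?_)
      · intro X Y x y
        have h1 := le_rda.1 (le_refl (rda (G.graph : (B : QDist Q) ⟶ A) (𝟙 (A : QDist Q))))
        have h2 := QDistributor.comp_le_iff.1 h1 x y (G.obj y)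
        have h3 := comp_mono (le_refl ((rda (G.graph : (B : QDist Q) ⟶ A)
          (𝟙 (A : QDist Q)) : QDistributor A B).val x y)) (A.id_le (G.obj y))
        rw [Category.comp_id] at h3
        exact h3.trans h2
      · exact QDistributor.comp_le_iff.2 fun x y z => A.comp_le x (G.obj y) z
    exact e1.trans (key.trans e2.symm)

theorem QFunctor.cograph_comp {A B D : QCategory Q} (F : QFunctor A B) (G : QFunctor B D) :
    (F.comp G).cograph = G.cograph.comp F.cograph := by
  refine le_antisymm ?_ (QDistributor.comp_le_iff.2 fun x y z => ?_)
  · intro X Y x y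
    refine le_trans ?_ (QDistributor.le_comp _ _ x (F.obj y) y)
    have := comp_mono (le_refl (D.hom x (G.obj (F.obj y)))) (B.id_le (F.obj y))
    rwa [Category.comp_id] at this
  · exact (comp_mono le_rfl (G.hom_le y (F.obj z))).trans (D.comp_le _ _ _)

theorem QFunctor.graph_comp {A B D : QCategory Q} (F : QFunctor A B) (G : QFunctor B D) :
    (F.comp G).graph = F.graph.comp G.graph := by
  refine le_antisymm ?_ (QDistributor.comp_le_iff.2 fun x y z => ?_)
  · intro X Y x y
    refine le_trans ?_ (QDistributor.le_comp _ _ x (F.obj x) y)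
    have := comp_mono (B.id_le (F.obj x)) (le_refl (D.hom (G.obj (F.obj x)) y))
    rwa [Category.id_comp] at this
  · exact (comp_mono (G.hom_le (F.obj x) y) le_rfl).trans (D.comp_le _ _ _)

/-- The 2-functor `J : Q-CCat → ChuCon(Q-Dist)^op`. It sends `A` to the identity distributor on `A`
and a left adjoint `F` with right adjoint `G` to the Chu connection `(F^♮, G_♮)`. -/
noncomputable def functorJ (Q : Type u) [Category.{u} Q] [Quantaloid Q] :
    TwoFunctor (QCCat Q) (ChuCon (QDist Q))ᵒᵖ where
  obj A := Opposite.op (ChuCon.mk (𝟙 (A.toQCategory : QDist Q)))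
  map F := (QCCat.adj F).chuHom.op
  map_id A := by
    apply Quiver.Hom.unop_inj
    refine ChuCon.Hom.ext rfl ?_
    have : QCCat.rightAdj (𝟙 A) = QFunctor.id A.toQCategory :=
      QFunctor.Adj.unique A.skeletal (QCCat.adj (𝟙 A))
        ⟨fun x => A.le_refl x, fun x => A.le_refl x⟩
    change (QCCat.rightAdj (𝟙 A)).graph = _
    rw [this]
    rfl
  map_comp {A B D} F G := by
    apply Quiver.Hom.unop_inj
    refine ChuCon.Hom.ext (QFunctor.cograph_comp _ _) ?_
    have : QCCat.rightAdj (F ≫ G) = (QCCat.rightAdj G).comp (QCCat.rightAdj F) :=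
      QFunctor.Adj.unique A.skeletal (QCCat.adj (F ≫ G)) ((QCCat.adj F).comp (QCCat.adj G))
    change (QCCat.rightAdj (F ≫ G)).graph = _
    rw [this]
    exact QFunctor.graph_comp _ _
  map_le_map {A B F G} h := by
    refine ⟨fun _ _ y x => B.hom_le_of_le_right y (h x), fun _ _ y x => ?_⟩
    change A.hom ((QCCat.rightAdj F).obj y) x ≤ A.hom ((QCCat.rightAdj G).obj y) x
    refine A.hom_le_of_le_left x ?_
    have h1 := B.le_trans (h ((QCCat.rightAdj G).obj y)) ((QCCat.adj G).2 y)
    exact h1.trans_eq ((QCCat.adj F).hom_eq _ _)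

/-! ## The 2-functor `M` -/

/-- The Isbell map `φ_↑ : PA → P†B`, `μ ↦ φ ↙ μ`; a copresheaf of type `X` on `B` is a distributor
from the one-object `Q`-category of type `X` to `B`. -/
def isbellUp {A B : QDist Q} (φ : A ⟶ B) {X : Q} (μ : Presheaf A X) :
    (starCat X : QDist Q) ⟶ B := lda φ μ

/-- The Isbell map `φ^↓ : P†B → PA`, `l ↦ l ↘ φ`. -/
def isbellDown {A B : QDist Q} (φ : A ⟶ B) {X : Q} (l : (starCat X : QDist Q) ⟶ B) :
    Presheaf A X := rda l φ

/-- The action of the `Q`-monad `φ^↓ φ_↑` on presheaves. -/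
def isbellClosure {A B : QDist Q} (φ : A ⟶ B) {X : Q} (μ : Presheaf A X) : Presheaf A X :=
  isbellDown φ (isbellUp φ μ)

section Closure

variable {A B : QDist Q} (φ : A ⟶ B)

theorem le_isbellClosure {X : Q} (μ : Presheaf A X) : μ ≤ isbellClosure φ μ :=
  le_rda.2 (le_lda.1 le_rfl)

theorem isbellClosure_mono {X : Q} {μ ν : Presheaf A X} (h : μ ≤ ν) :
    isbellClosure φ μ ≤ isbellClosure φ ν :=
  le_rda.2 ((comp_mono le_rfl (le_lda.2 ((comp_mono h le_rfl).trans (le_lda.1 le_rfl)))).trans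
    (le_rda.1 (le_refl (isbellClosure φ μ))))

theorem isbellClosure_idem {X : Q} (μ : Presheaf A X) :
    isbellClosure φ (isbellClosure φ μ) = isbellClosure φ μ :=
  le_antisymm
    (le_rda.2 ((comp_mono le_rfl (le_lda.2 (le_rda.1 le_rfl))).trans (le_rda.1 le_rfl)))
    (le_isbellClosure φ _)

theorem isbellClosure_comp_le {X Y : Q} (μ : Presheaf A X) (g : (starCat X : QDist Q) ⟶ starCat Y) :
    isbellClosure φ μ ≫ g ≤ isbellClosure φ (μ ≫ g) := by
  refine le_rda.2 ?_
  rw [Category.assoc]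
  have h : g ≫ lda φ (μ ≫ g) ≤ lda φ μ := by
    rw [le_lda, ← Category.assoc]
    exact le_lda.1 le_rfl
  exact (comp_mono le_rfl h).trans (le_rda.1 (le_refl (isbellClosure φ μ)))

theorem homPA_isbellClosure {X Y : Q} (μ : Presheaf A X) {ν : Presheaf A Y}
    (hν : isbellClosure φ ν = ν) : homPA (isbellClosure φ μ) ν = homPA μ ν := by
  refine le_antisymm (le_homPA'.2 ?_) (le_homPA'.2 ?_)
  · exact (comp_mono (le_isbellClosure φ μ) le_rfl).trans (le_homPA'.1 le_rfl)
  · refine (isbellClosure_comp_le φ μ _).trans ?_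
    conv_rhs => rw [← hν]
    exact isbellClosure_mono φ (le_homPA'.1 le_rfl)

/-- The `Q`-category `Mφ`: the full `Q`-subcategory of `PA` on the fixed points of `φ^↓ φ_↑`. -/
abbrev fixCat : QCategory Q :=
  (presheafCat A).full fun {_} (μ : Presheaf A _) => isbellClosure φ μ = μ

theorem fixCat_skeletal : (fixCat φ).Skeletal := fun _ _ h h' =>
  Subtype.ext (le_antisymm (one_le_homPA.1 h) (one_le_homPA.1 h'))

/-- The distributor `A ⇸ Mφ` with value `μ(x)` at `(x, μ)`. -/
def evalDist : A ⟶ (fixCat φ : QDist Q) where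
  val x μ := Presheaf.at μ.1 x
  act_le x' x μ μ' := by
    have h1 : Presheaf.at μ.1 x ≫ homPA μ.1 μ'.1 ≤ Presheaf.at μ'.1 x :=
      le_homPA.1 le_rfl x
    exact (comp_mono le_rfl h1).trans (QDistributor.act_left μ'.1 x' x StarObj.pt)

theorem le_fixCat_sup {X Y : Q} (Θ : Presheaf (fixCat φ : QDist Q) X) (ν : (fixCat φ).Obj Y)
    (f : X ⟶ Y) :
    f ≤ homPA (isbellClosure φ (evalDist φ ≫ Θ)) ν.1 ↔
      ∀ {Z : Q} (μ : (fixCat φ).Obj Z), Θ.at μ ≫ f ≤ homPA μ.1 ν.1 := by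
  rw [homPA_isbellClosure φ _ ν.2, le_homPA]
  constructor
  · intro h Z μ
    refine le_homPA.2 fun x => ?_
    refine le_trans ?_ (h x)
    rw [← Category.assoc]
    exact comp_mono (QDistributor.le_comp (evalDist φ) Θ x μ StarObj.pt) le_rfl
  · intro h Z x
    rw [Presheaf.comp_at, QDistributor.iSup₂_comp']
    intro W μ
    rw [Category.assoc]
    exact (comp_mono le_rfl (h μ)).trans
      (le_homPA.1 (le_refl (homPA μ.1 ν.1)) x)

theorem fixCat_complete : (fixCat φ).Complete := by
  refine ⟨⟨fun {X} Θ => ⟨isbellClosure φ (evalDist φ ≫ Θ), isbellClosure_idem φ _⟩, ?_⟩, ?_, ?_⟩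
  · intro X Y Θ Θ'
    refine (le_fixCat_sup φ Θ ⟨_, isbellClosure_idem φ _⟩ _).2 fun {Z} μ => ?_
    refine (le_homPA.1 le_rfl μ).trans (le_homPA.2 fun x => ?_)
    exact (QDistributor.le_comp (evalDist φ) Θ' x μ StarObj.pt).trans
      (Presheaf.le_iff.1 (le_isbellClosure φ (evalDist φ ≫ Θ')) x)
  · intro X Θ
    refine one_le_homPA.2 (Presheaf.le_iff.2 fun {Z} μ => ?_)
    refine le_homPA.2 fun x => ?_
    exact (QDistributor.le_comp (evalDist φ) Θ x μ StarObj.pt).trans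
      (Presheaf.le_iff.1 (le_isbellClosure φ (evalDist φ ≫ Θ)) x)
  · intro X ν
    refine (le_fixCat_sup φ (yonedaObj (fixCat φ) ν) ν _).2 fun {Z} μ => ?_
    rw [Category.comp_id]
    exact le_rfl

end Closure

/-- The object part of `M`. -/
def objM (φ : ChuCon (QDist Q)) : QCCat Q where
  toQCategory := fixCat φ.arr
  skeletal := fixCat_skeletal φ.arr
  complete := fixCat_complete φ.arr

theorem chu_closure_le {φ ψ : ChuCon (QDist Q)} (p : φ ⟶ ψ) {X : Q} (μ : Presheaf ψ.dom X) :
    p.u ≫ isbellClosure ψ.arr μ ≤ isbellClosure φ.arr (p.u ≫ μ) := by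
  refine le_rda.2 ?_
  rw [isbellUp, lda_comp, p.lda_eq_rda, rda_lda]
  have h1 : isbellClosure ψ.arr μ ≫ rda p.v (lda ψ.arr μ) ≤ rda p.v ψ.arr := by
    refine le_rda.2 ?_
    rw [Category.assoc]
    exact (comp_mono le_rfl (le_rda.1 le_rfl)).trans
      (le_rda.1 (le_refl (isbellClosure ψ.arr μ)))
  rw [Category.assoc]
  rw [← p.lda_eq_rda] at h1
  exact (comp_mono le_rfl h1).trans (le_lda.1 le_rfl)

/-- The arrow part of `M`: a Chu connection `(ζ, η) : φ ⟶ ψ` gives the `Q`-functor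
`μ' ↦ φ^↓ φ_↑ (μ' ∘ ζ)` from `Mψ` to `Mφ`. -/
def mapM {φ ψ : ChuCon (QDist Q)} (p : φ ⟶ ψ) :
    QFunctor (fixCat ψ.arr) (fixCat φ.arr) where
  obj μ := ⟨isbellClosure φ.arr (p.u ≫ μ.1), isbellClosure_idem _ _⟩
  hom_le {X Y} μ ν := by
    change homPA μ.1 ν.1 ≤ homPA (isbellClosure φ.arr (p.u ≫ μ.1)) _
    rw [homPA_isbellClosure _ _ (isbellClosure_idem _ _)]
    refine le_homPA'.2 ?_
    rw [Category.assoc]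
    exact (comp_mono le_rfl (le_homPA'.1 le_rfl)).trans (le_isbellClosure _ _)

theorem mapM_exists_adj {φ ψ : ChuCon (QDist Q)} (p : φ ⟶ ψ) :
    ∃ G : QFunctor (fixCat φ.arr) (fixCat ψ.arr), (mapM p).Adj G := by
  have fix : ∀ {X : Q} (μ : (fixCat φ.arr).Obj X),
      isbellClosure ψ.arr (lda μ.1 p.u) = lda μ.1 p.u := fun {X} μ => by
    refine le_antisymm (le_lda.2 ?_) (le_isbellClosure _ _)
    refine (chu_closure_le p _).trans ?_
    conv_rhs => rw [← μ.2]
    exact isbellClosure_mono _ (le_lda.1 le_rfl)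
  refine ⟨⟨fun μ => ⟨lda μ.1 p.u, fix μ⟩, ?_⟩, ?_, ?_⟩
  · intro X Y μ ν
    refine le_homPA'.2 (le_lda.2 ?_)
    rw [← Category.assoc]
    exact (comp_mono (le_lda.1 le_rfl) le_rfl).trans
      (le_homPA'.1 (le_refl (homPA μ.1 ν.1)))
  · intro X μ
    exact one_le_homPA.2 (le_lda.2 (le_isbellClosure _ _))
  · intro X μ
    refine one_le_homPA.2 ?_
    change isbellClosure φ.arr (p.u ≫ lda μ.1 p.u) ≤ μ.1
    conv_rhs => rw [← μ.2]
    exact isbellClosure_mono _ (le_lda.1 le_rfl)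

/-- The 2-functor `M : ChuCon(Q-Dist)^op → Q-CCat`. -/
def functorM (Q : Type u) [Category.{u} Q] [Quantaloid Q] :
    TwoFunctor (ChuCon (QDist Q))ᵒᵖ (QCCat Q) where
  obj φ := objM φ.unop
  map p := ⟨mapM p.unop, mapM_exists_adj p.unop⟩
  map_id φ := by
    refine QCCat.Hom.ext ?_
    ext X μ
    refine Subtype.ext ?_
    change isbellClosure _ (𝟙 _ ≫ μ.1) = μ.1
    rw [Category.id_comp]
    exact μ.2
  map_comp p q := by
    refine QCCat.Hom.ext ?_
    ext X μ
    refine Subtype.ext ?_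
    change isbellClosure _ ((q.unop.u ≫ p.unop.u) ≫ μ.1) =
      isbellClosure _ (q.unop.u ≫ isbellClosure _ (p.unop.u ≫ μ.1))
    rw [Category.assoc]
    refine le_antisymm (isbellClosure_mono _ (comp_mono le_rfl (le_isbellClosure _ _))) ?_
    refine (isbellClosure_mono _ (chu_closure_le q.unop _)).trans ?_
    rw [isbellClosure_idem]
  map_le_map {_ _ p q} h := fun μ =>
    one_le_homPA.2 (isbellClosure_mono _ (comp_mono h.1 le_rfl))

end QEnriched

/-!
The right adjoint of an arrow is unique because the categories are skeletal, and this pins down the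
values of `J`.

For a complete `Q`-category `A` with `sup ⊣ Y`, the closure operator of the identity distributor is
computed pointwise: `(1 ↙ μ)(a) = PA(μ, Y a) = A(sup μ, a)`, and the largest presheaf that composes
with `A(sup μ, -)` into `A` is `A(-, sup μ)`. Hence the closure of `μ` is `Y (sup μ)`
(`isbellClosure_one`), so the fixed points are exactly the representable presheaves. As `A` is
skeletal, `Y` and `sup` restrict to mutually inverse `Q`-functors between `A` and `MJA`, and mutually
inverse `Q`-functors are adjoint to each other in both directions. Naturality says that
`F^♮` followed by `A(-, x)` is `B(-, F x)` (`cograph_comp_yonedaObj`).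

Finally `J` is injective on objects, since `A` is the domain of `J A`. A functor whose values are
replaced by isomorphic objects is again a functor, so `M` may be changed to take the value `A` itself
at `J A`, the isomorphism being the Yoneda one; by naturality the modified functor composes with `J`
to the identity on the nose (`TwoFunctor.exists_strict_retraction`).
-/

/-! ### Strictifying a retraction up to isomorphism -/

/-- The 2-functor isomorphic to `G` whose value at `X` is replaced by the isomorphic object
`obj X`. -/
def TwoFunctor.copyObj {C : Type w₁} [Category.{v₁} C] [LocallyOrdered C]
    {D : Type w₂} [Category.{v₂} D] [LocallyOrdered D] (G : TwoFunctor C D) (obj : C → D)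
    (e : ∀ X, G.obj X ≅ obj X) : TwoFunctor C D where
  toFunctor := G.toFunctor.copyObj obj e
  map_le_map h := LocallyOrdered.comp_le_comp le_rfl
    (LocallyOrdered.comp_le_comp (G.map_le_map h) le_rfl)

/-- If `J` is injective on objects and `J` followed by `M` is isomorphic to the identity, then `M`
can be replaced by an isomorphic 2-functor that is a strict retraction of `J`. -/
theorem TwoFunctor.exists_strict_retraction {C : Type w₁} [Category.{v₁} C] [LocallyOrdered C]
    {D : Type w₂} [Category.{v₂} D] [LocallyOrdered D] (J : TwoFunctor C D) (M : TwoFunctor D C)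
    (hJ : Function.Injective J.obj)
    (e : (TwoFunctor.id C).toFunctor ≅ (J.comp M).toFunctor) :
    ∃ R : TwoFunctor D C, J.comp R = TwoFunctor.id C := by
  -- Object and isomorphism are chosen together, so that both are known at once in the image of `J`.
  have hdata : ∀ X : D, ∃ d : Σ B : C, M.obj X ≅ B, ∀ (A : C) (h : J.obj A = X),
      d = ⟨A, (M.mapIso (eqToIso h)).symm ≪≫ (e.app A).symm⟩ := by
    intro X
    by_cases hX : ∃ A, J.obj A = X
    · obtain ⟨A, rfl⟩ := hX
      refine ⟨⟨A, (M.mapIso (eqToIso rfl)).symm ≪≫ (e.app A).symm⟩, fun A' h => ?_⟩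
      obtain rfl := hJ h
      rfl
    · exact ⟨⟨M.obj X, Iso.refl _⟩, fun A h => absurd ⟨A, h⟩ hX⟩
  choose d hd using hdata
  have hdJ : ∀ A, d (J.obj A) = ⟨A, (e.app A).symm⟩ := fun A => by
    rw [hd _ A rfl]
    congr 1
    ext
    simp only [eqToIso_refl, Functor.mapIso_refl]
    exact Category.id_comp _
  have hobj : ∀ A, (d (J.obj A)).1 = A := fun A => by rw [hdJ A]
  refine ⟨M.copyObj (fun X => (d X).1) fun X => (d X).2, ?_⟩
  have hfun : (J.comp (M.copyObj (fun X => (d X).1) fun X => (d X).2)).toFunctor =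
      (TwoFunctor.id C).toFunctor := by
    refine CategoryTheory.Functor.ext hobj fun A B f => ?_
    change (d (J.obj A)).2.inv ≫ M.map (J.map f) ≫ (d (J.obj B)).2.hom = eqToHom _ ≫ f ≫ eqToHom _
    have key : ∀ (a : Σ A' : C, M.obj (J.obj A) ≅ A') (b : Σ B' : C, M.obj (J.obj B) ≅ B')
        (ha : a = ⟨A, (e.app A).symm⟩) (hb : b = ⟨B, (e.app B).symm⟩),
        a.2.inv ≫ M.map (J.map f) ≫ b.2.hom =
          eqToHom (by rw [ha]) ≫ f ≫ eqToHom (by rw [hb]) := by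
      rintro _ _ rfl rfl
      exact (NatIso.naturality_2 e f).trans
        ((Category.id_comp _).trans (Category.comp_id f)).symm
    exact key _ _ (hdJ A) (hdJ B)
  revert hfun
  generalize J.comp (M.copyObj (fun X => (d X).1) fun X => (d X).2) = S
  generalize TwoFunctor.id C = T
  obtain ⟨S, _⟩ := S
  obtain ⟨T, _⟩ := T
  rintro rfl
  rfl

/-! ### The closure operator of the identity distributor -/

section Representable

variable {Q : Type u} [Category.{u} Q] [Quantaloid Q]

/-- The enriched Yoneda lemma: the presheaf morphisms out of `A(-, x)` are the values at `x`. -/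
theorem homPA_yonedaObj (A : QCategory Q) {X Y : Q} (x : A.Obj X) (μ : Presheaf A Y) :
    homPA (yonedaObj A x) μ = Presheaf.at μ x := by
  refine le_antisymm ?_ (le_homPA.2 fun z => QDistributor.act_left μ z x StarObj.pt)
  have h := (comp_mono (A.id_le x) le_rfl).trans
    (le_homPA.1 (le_refl (homPA (yonedaObj A x) μ)) x)
  rwa [Category.id_comp] at h

/-- The values of the Isbell map of the identity: `(1 ↙ μ)(a) = PA(μ, Y a)`. -/
theorem isbellUp_one_val (A : QDist Q) {X Y : Q} (μ : Presheaf A X) (a : A.Obj Y) :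
    QDistributor.val (isbellUp (𝟙 A) μ) StarObj.pt a = homPA μ (yonedaObj A a) := by
  refine le_antisymm (le_homPA.2 fun x => ?_) ?_
  · exact QDistributor.comp_le_iff.1 (le_lda.1 (le_refl (isbellUp (𝟙 A) μ))) x StarObj.pt a
  · -- The arrows `PA(μ, Y -)` form a distributor, to be compared with the implication `1 ↙ μ`.
    let l : (starCat X : QDist Q) ⟶ A :=
      { val := fun {V W} s b => match V, s with
          | _, .pt => homPA μ (yonedaObj A b)
        act_le := fun s' s b b' => by
          cases s; cases s'
          change 𝟙 X ≫ homPA μ (yonedaObj A b) ≫ A.hom b b' ≤ homPA μ (yonedaObj A b')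
          rw [Category.id_comp]
          exact (comp_mono le_rfl ((yonedaEmb A).hom_le b b')).trans
            ((presheafCat A).comp_le _ _ _) }
    have hl : l ≤ isbellUp (𝟙 A) μ := le_lda.2 <| QDistributor.comp_le_iff.2 fun x s b => by
      cases s
      exact le_homPA.1 (le_refl (homPA μ (yonedaObj A b))) x
    exact hl X Y StarObj.pt a

/-- In a complete `Q`-category the closure of `μ` under the identity distributor is the presheaf
represented by the supremum of `μ`. -/
theorem isbellClosure_one {A : QCategory Q} {sup : QFunctor (presheafCat A) A}
    (h : sup.Adj (yonedaEmb A)) {X : Q} (μ : Presheaf A X) :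
    isbellClosure (𝟙 (A : QDist Q)) μ = yonedaObj A (sup.obj μ) := by
  have hval : ∀ {Y : Q} (a : A.Obj Y),
      QDistributor.val (isbellUp (𝟙 (A : QDist Q)) μ) StarObj.pt a = A.hom (sup.obj μ) a :=
    fun a => (isbellUp_one_val A μ a).trans (h.hom_eq μ a).symm
  refine le_antisymm (Presheaf.le_iff.2 fun {Z} x => ?_) (le_rda.2 ?_)
  · have h1 := QDistributor.comp_le_iff.1
      (le_rda.1 (le_refl (isbellClosure (𝟙 (A : QDist Q)) μ))) x StarObj.pt (sup.obj μ)
    rw [hval] at h1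
    have h2 := (comp_mono le_rfl (A.id_le (sup.obj μ))).trans h1
    rwa [Category.comp_id] at h2
  · refine QDistributor.comp_le_iff.2 fun x s a => ?_
    cases s
    rw [hval]
    exact A.comp_le x (sup.obj μ) a

/-! ### The Yoneda isomorphism -/

namespace QCCat

variable (A : QCCat Q)

/-- A left adjoint of the Yoneda embedding, the supremum `Q`-functor. -/
noncomputable def sup : QFunctor (presheafCat A.toQCategory) A.toQCategory := A.complete.choose

theorem sup_adj : A.sup.Adj (yonedaEmb A.toQCategory) := A.complete.choose_spec

theorem sup_yonedaObj {X : Q} (x : A.Obj X) : A.sup.obj (yonedaObj A.toQCategory x) = x := by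
  refine A.skeletal _ _ (A.sup_adj.2 x) ?_
  have h := A.sup_adj.1 (yonedaObj A.toQCategory x)
  exact h.trans_eq (homPA_yonedaObj A.toQCategory x _)

theorem isbellClosure_yonedaObj {X : Q} (x : A.Obj X) :
    isbellClosure (𝟙 (A.toQCategory : QDist Q)) (yonedaObj A.toQCategory x) =
      yonedaObj A.toQCategory x := by
  rw [isbellClosure_one A.sup_adj, sup_yonedaObj]

/-- The Yoneda embedding with codomain restricted to the fixed points of the closure operator. -/
def yonedaFix : QFunctor A.toQCategory (fixCat (𝟙 (A.toQCategory : QDist Q))) where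
  obj x := ⟨yonedaObj A.toQCategory x, A.isbellClosure_yonedaObj x⟩
  hom_le x y := (yonedaEmb A.toQCategory).hom_le x y

/-- The supremum `Q`-functor restricted to the fixed points of the closure operator. -/
noncomputable def supFix : QFunctor (fixCat (𝟙 (A.toQCategory : QDist Q))) A.toQCategory where
  obj μ := A.sup.obj μ.1
  hom_le μ ν := A.sup.hom_le μ.1 ν.1

theorem yonedaFix_supFix {X : Q} (μ : (fixCat (𝟙 (A.toQCategory : QDist Q))).Obj X) :
    A.yonedaFix.obj (A.supFix.obj μ) = μ :=
  Subtype.ext ((isbellClosure_one A.sup_adj μ.1).symm.trans μ.2)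

theorem supFix_yonedaFix {X : Q} (x : A.Obj X) : A.supFix.obj (A.yonedaFix.obj x) = x :=
  A.sup_yonedaObj x

theorem yonedaFix_adj : A.yonedaFix.Adj A.supFix :=
  ⟨fun x => (A.id_le x).trans_eq (congrArg (A.hom x) (A.supFix_yonedaFix x).symm),
    fun μ => (QCategory.id_le _ μ).trans_eq
      (congrArg (fun ν => QCategory.hom _ ν μ) (A.yonedaFix_supFix μ).symm)⟩

theorem supFix_adj : A.supFix.Adj A.yonedaFix :=
  ⟨fun μ => (QCategory.id_le _ μ).trans_eq
      (congrArg (fun ν => QCategory.hom _ μ ν) (A.yonedaFix_supFix μ).symm),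
    fun x => (A.id_le x).trans_eq (congrArg (fun y => A.hom y x) (A.supFix_yonedaFix x).symm)⟩

/-- The Yoneda embedding as an isomorphism between `A` and `MJA`. -/
noncomputable def yonedaIso : A ≅ (functorM Q).obj ((functorJ Q).obj A) where
  hom := ⟨A.yonedaFix, A.supFix, A.yonedaFix_adj⟩
  inv := ⟨A.supFix, A.yonedaFix, A.supFix_adj⟩
  hom_inv_id := by
    refine QCCat.Hom.ext ?_
    ext X x
    exact A.supFix_yonedaFix x
  inv_hom_id := by
    refine QCCat.Hom.ext ?_
    ext X μ
    exact A.yonedaFix_supFix μ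

end QCCat

/-- Precomposition with the cograph of `F` sends the presheaf represented by `x` to the one
represented by `F x`. -/
theorem cograph_comp_yonedaObj {A B : QCategory Q} (F : QFunctor A B) {X : Q} (x : A.Obj X) :
    ((F.cograph : (B : QDist Q) ⟶ A) ≫ yonedaObj A x : Presheaf B X) =
      yonedaObj B (F.obj x) := by
  refine le_antisymm (QDistributor.comp_le_iff.2 fun b a s => ?_)
    (Presheaf.le_iff.2 fun {Z} b => ?_)
  · cases s
    exact (comp_mono le_rfl (F.hom_le a x)).trans (B.comp_le b _ _)
  · have h1 := QDistributor.le_comp F.cograph (yonedaObj A x) b x StarObj.pt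
    have h2 := (comp_mono (le_refl (B.hom b (F.obj x))) (A.id_le x)).trans h1
    rwa [Category.comp_id] at h2

/-- The Yoneda isomorphisms are natural in left adjoint `Q`-functors. -/
noncomputable def yonedaNatIso (Q : Type u) [Category.{u} Q] [Quantaloid Q] :
    (TwoFunctor.id (QCCat Q)).toFunctor ≅ ((functorJ Q).comp (functorM Q)).toFunctor :=
  NatIso.ofComponents (fun A => A.yonedaIso) fun {A B} F => by
    refine QCCat.Hom.ext ?_
    ext X x
    refine Subtype.ext ?_
    change yonedaObj B.toQCategory (F.functor.obj x) =
      isbellClosure (𝟙 (B.toQCategory : QDist Q))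
        ((F.functor.cograph : (B.toQCategory : QDist Q) ⟶ A.toQCategory) ≫
          yonedaObj A.toQCategory x)
    exact ((congrArg (isbellClosure (𝟙 (B.toQCategory : QDist Q)))
      (cograph_comp_yonedaObj F.functor x)).trans (B.isbellClosure_yonedaObj _)).symm

theorem functorJ_obj_injective (Q : Type u) [Category.{u} Q] [Quantaloid Q] :
    Function.Injective (functorJ Q).obj := by
  rintro ⟨A, _, _⟩ ⟨B, _, _⟩ h
  obtain rfl : A = B := congrArg (fun φ => φ.unop.dom) h
  rfl

end Representable

theorem theorem3p8 (Q : Type u) [Category.{u} Q] [Quantaloid Q] :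
    -- `J` sends every `A` to the identity distributor and every `F ⊣ G` to `(F^♮, G_♮)`
    ((∀ A : QCCat Q,
        (functorJ Q).obj A = Opposite.op (ChuCon.mk (𝟙 (A.toQCategory : QDist Q)))) ∧
      ∀ (A B : QCCat Q) (F : A ⟶ B) (G : QFunctor B.toQCategory A.toQCategory),
        F.functor.Adj G →
          ((functorJ Q).map F).unop.u = F.functor.cograph ∧
          ((functorJ Q).map F).unop.v = G.graph) ∧
    -- the Yoneda embeddings form a (2-)natural isomorphism from the identity to `M ∘ J`
    (∃ e : (TwoFunctor.id (QCCat Q)).toFunctor ≅ ((functorJ Q).comp (functorM Q)).toFunctor,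
      ∀ (A : QCCat Q) (X : Q) (x : A.Obj X),
        ((e.hom.app A).functor.obj x).1 = (yonedaEmb A.toQCategory).obj x) ∧
    -- `J` is a section in 2-CAT
    ∃ R : TwoFunctor (ChuCon (QDist Q))ᵒᵖ (QCCat Q),
      (functorJ Q).comp R = TwoFunctor.id (QCCat Q) := by
  refine ⟨⟨fun A => rfl, fun A B F G h => ⟨rfl, ?_⟩⟩, ⟨yonedaNatIso Q, fun A X x => rfl⟩,
    TwoFunctor.exists_strict_retraction _ (functorM Q) (functorJ_obj_injective Q)
      (yonedaNatIso Q)⟩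
  change (QCCat.rightAdj F).graph = G.graph
  rw [QFunctor.Adj.unique A.skeletal (QCCat.adj F) h]
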